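/- Let $U=(U_n)_{n\ge 0}$ be a positional numeration system, i.e. an increasing sequence of integers with $U_0=1$ and $\sup_n U_{n+1}/U_n<\infty$; write $\mathrm{rep}_U(x)$ for the greedy $U$-representation of $x\in\mathbb N$, most significant digit first. Let $p\ge 1$ and suppose that $U$ has an associated alternate real base $B=(\beta_0,\ldots,\beta_{p-1})$, meaning that the limits $\beta_i=\lim_{n\to\infty}U_{np-i}/U_{np-i-1}$ exist for all $i\in\{0,\ldots,p-1\}$ (they are then $\ge 1$); put $\beta_n=\beta_{n\bmod p}$ for all $n\ge 0$. For $i\in\{0,\ldots,p-1\}$, let $\mathbf d_i=t_{i,0}t_{i,1}t_{i,2}\cdots$ be the greedy expansion of $1$ in the shifted base $(\beta_i,\ldots,\beta_{i+p-1})$: $r_0=1$, $t_{i,n}=\lfloor\beta_{i+n}r_n\rfloor$, $r_{n+1}=\beta_{i+n}r_n-t_{i,n}$. If $\mathbf d_i$ is finite (ends in $0^\omega$), let $\ell_i$ be the length of its prefix up to its last nonzero digit, let $\sigma(i)=(i+\ell_i)\bmod p$, and let $$(\Delta_i)_n=U_{np-i}-\sum_{\ell=1}^{\ell_i}t_{i,\ell-1}U_{np-i-\ell}\qquad(np-i\ge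 \ell_i),$$ extended by $0$ for the finitely many other $n\geq 0$; otherwise $\sigma(i)$ is undefined. Let $L_i=\{\mathrm{rep}_U(U_{np-i}-1):n\ge 1\}$. **Proposition.** Let $i\in\{0,\ldots,p-1\}$ be such that there exist $s\ge 1$ and $r\ge 1$ for which $\sigma^{s+r}(i)$ and $\sigma^s(i)$ are defined and $\sigma^{s+r}(i)=\sigma^s(i)$, with $s$ minimal among the integers $s\geq 1$ for which such an $r$ exists. If the languages $L_i,L_{\sigma(i)},\ldots,L_{\sigma^{s+r-1}(i)}$ are all regular, then there is an integer $M\ge 1$ such that the following two (equivalent) conditions hold: (a) $\Delta_i$ is a linear recurrence sequence, and all its nonzero eigenvalues (the nonzero complex roots of its minimal polynomial, the monic generator of the ideal of polynomials $\sum_k c_kX^k$ with $\sum_k c_k(\Delta_i)_{n+k}=0$ for all $n\ge 0$) are $M$-th roots of unity and have multiplicity at most $2$ as roots of the minimal polynomial; (b) the sequence $\big((\Delta_i)_{n+M}-(\Delta_i)_n\big)_{n\ge 0}$ is ultimately periodic with period $M$. -/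

import Mathlib

open Filter Topology Polynomial

noncomputable section

namespace NumSys

/-! ### Positional numeration systems and greedy representations -/

/-- `U` is the base sequence of a positional numeration system: an increasing sequence of
integers with `U 0 = 1` whose quotients of consecutive terms are uniformly bounded. -/
structure IsPositional (U : ℕ → ℕ) : Prop where
  zero : U 0 = 1
  strictMono : StrictMono U
  bounded : ∃ C : ℝ, ∀ n, (U (n + 1) : ℝ) / (U n : ℝ) ≤ C

/-- The digits `a_{ℓ-1} ⋯ a_0` (most significant digit first) produced by the greedy algorithm
started at position `ℓ` with remainder `r_ℓ = x`, that is
`a_n = ⌊r_{n+1} / U_n⌋` and `r_n = r_{n+1} - a_n U_n`. -/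
def greedyDigits (U : ℕ → ℕ) : ℕ → ℕ → List ℕ
  | 0, _ => []
  | n + 1, x => (x / U n) :: greedyDigits U n (x % U n)

/-- The greedy `U`-representation of `x`: the greedy algorithm is started at the least `ℓ`
such that `x < U ℓ`. -/
def rep (U : ℕ → ℕ) (x : ℕ) : List ℕ :=
  greedyDigits U (sInf {l : ℕ | x < U l}) x

/-- The language `L_i = {rep_U(U_{np-i} - 1) : n ≥ 1}`. Words are written over `ℕ`; only
finitely many letters occur, so regularity over `ℕ` is regularity over the finite
numeration alphabet. -/
def maxLang (U : ℕ → ℕ) (p : ℕ) (i : Fin p) : Language ℕ :=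
  {w | ∃ n : ℕ, 1 ≤ n ∧ w = rep U (U (n * p - (i : ℕ)) - 1)}

/-! ### Alternate bases -/

/-- `B = (β_0, …, β_{p-1})` is an alternate real base associated with `U`:
`β_i = lim U_{np-i} / U_{np-i-1}` for every `i`. (As `U` is increasing, all `β_i ≥ 1`.) -/
def IsAssociatedBase (U : ℕ → ℕ) {p : ℕ} (β : Fin p → ℝ) : Prop :=
  ∀ i : Fin p, Tendsto
    (fun n : ℕ => (U (n * p - (i : ℕ)) : ℝ) / (U (n * p - (i : ℕ) - 1) : ℝ)) atTop (𝓝 (β i))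

variable {p : ℕ} [NeZero p]

/-- The remainders `r_n` of the greedy algorithm for `1` in the shifted base
`B^{(i)} = (β_i, …, β_{i+p-1})`; indices of `β` are read modulo `p`. -/
def remainder (β : Fin p → ℝ) (i : Fin p) : ℕ → ℝ
  | 0 => 1
  | n + 1 => Int.fract (β (Fin.ofNat p ((i : ℕ) + n)) * remainder β i n)

/-- The `n`-th digit `t_{i,n}` of the greedy `B^{(i)}`-expansion `d_i` of `1`. If `B = (1)`,
this gives `d_0 = 1 0^ω`. -/
def digit (β : Fin p → ℝ) (i : Fin p) (n : ℕ) : ℕ :=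
  ⌊β (Fin.ofNat p ((i : ℕ) + n)) * remainder β i n⌋₊

/-- The expansion `d_i` is finite, i.e., it ends in a tail of zeros. -/
def IsFiniteExp (β : Fin p → ℝ) (i : Fin p) : Prop :=
  ∃ N : ℕ, ∀ n ≥ N, digit β i n = 0

/-- The length `ℓ_i` of a finite expansion `d_i`: the length of its prefix up to the last
nonzero digit. -/
def len (β : Fin p → ℝ) (i : Fin p) : ℕ :=
  sInf {N : ℕ | ∀ n ≥ N, digit β i n = 0}

/-! ### The graph of the quasi-greedy algorithm -/

open Classical in
/-- The successor `σ(i) = (i + ℓ_i) mod p` of the vertex `i` when `d_i` is finite; there is no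
successor otherwise. -/
def succ (β : Fin p → ℝ) (i : Fin p) : Option (Fin p) :=
  if IsFiniteExp β i then some (Fin.ofNat p ((i : ℕ) + len β i)) else none

/-- The iterate `σ^k(i)`, where it exists. -/
def succIter (β : Fin p → ℝ) : ℕ → Fin p → Option (Fin p)
  | 0, i => some i
  | k + 1, i => (succIter β k i).bind (succ β)

/-- `σ^{s+r}(i)` and `σ^s(i)` exist and are equal. -/
def Returns (β : Fin p → ℝ) (i : Fin p) (s r : ℕ) : Prop :=
  ∃ v : Fin p, succIter β s i = some v ∧ succIter β (s + r) i = some v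

/-- The sequence `(Δ_i)_n = U_{np-i} - ∑_{ℓ=1}^{ℓ_i} t_{i,ℓ-1} U_{np-i-ℓ}`, defined for
`np - i ≥ ℓ_i`; the finitely many remaining terms are set to `0`. -/
def Delta (U : ℕ → ℕ) (β : Fin p → ℝ) (i : Fin p) (n : ℕ) : ℤ :=
  if (i : ℕ) + len β i ≤ n * p then
    (U (n * p - (i : ℕ)) : ℤ)
      - ∑ l ∈ Finset.Icc 1 (len β i), (digit β i (l - 1) : ℤ) * (U (n * p - (i : ℕ) - l) : ℤ)
  else 0

end NumSys

/-! ### Linear recurrence sequences and their eigenvalues -/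

namespace LinSeq

variable {K : Type*} [Field K]

/-- The ideal of the polynomials `c_m X^m + ⋯ + c_0` such that
`c_m x_{n+m} + ⋯ + c_0 x_n = 0` for all `n`. -/
def annIdeal (x : ℕ → K) : Ideal K[X] where
  carrier := {P | ∀ n : ℕ, P.sum (fun k c => c * x (n + k)) = 0}
  zero_mem' := fun n => by simp
  add_mem' := fun {P Q} hP hQ n => by
    rw [Polynomial.sum_add_index _ _ _ (by simp) (by intros; ring), hP n, hQ n, add_zero]
  smul_mem' := fun Q P hP => by
    induction Q using Polynomial.induction_on' with
    | add Q R hQ hR =>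
      intro n
      rw [smul_eq_mul, add_mul, Polynomial.sum_add_index _ _ _ (by simp) (by intros; ring)]
      have h1 := hQ n
      have h2 := hR n
      rw [smul_eq_mul] at h1 h2
      rw [h1, h2, add_zero]
    | monomial m a =>
      intro n
      have h := hP (n + m)
      rw [Polynomial.sum_over_range' _ (by simp) (P.natDegree + 1) (Nat.lt_succ_self _)] at h
      have hd : ((monomial m a) • P).natDegree < m + (P.natDegree + 1) := by
        rw [smul_eq_mul]
        refine lt_of_le_of_lt Polynomial.natDegree_mul_le ?_
        have := Polynomial.natDegree_monomial_le a (m := m)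
        omega
      rw [Polynomial.sum_over_range' _ (by simp) _ hd, Finset.sum_range_add]
      have hz : ∑ k ∈ Finset.range m, ((monomial m a) • P).coeff k * x (n + k) = 0 := by
        refine Finset.sum_eq_zero fun k hk => ?_
        rw [smul_eq_mul, ← Polynomial.C_mul_X_pow_eq_monomial, mul_assoc, Polynomial.coeff_C_mul,
          Polynomial.coeff_X_pow_mul', if_neg, mul_zero, zero_mul]
        have := Finset.mem_range.mp hk
        omega
      rw [hz, zero_add]
      have hc : ∀ k, ((monomial m a) • P).coeff (m + k) = a * P.coeff k := fun k => by
        rw [smul_eq_mul, ← Polynomial.C_mul_X_pow_eq_monomial, mul_assoc, Polynomial.coeff_C_mul,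
          Polynomial.coeff_X_pow_mul', if_pos (Nat.le_add_right m k), Nat.add_sub_cancel_left]
      simp only [hc, ← add_assoc, mul_assoc]
      rw [← Finset.mul_sum, h, mul_zero]

open Classical in
/-- The minimal polynomial of a sequence: the monic generator of `annIdeal x`
(it is `0` if `x` satisfies no linear recurrence relation). -/
def minPoly (x : ℕ → K) : K[X] :=
  normalize (Submodule.IsPrincipal.generator (annIdeal x))

theorem span_minPoly (x : ℕ → K) : Ideal.span {minPoly x} = annIdeal x := by
  classical
  rw [← Ideal.span_singleton_generator (annIdeal x)]
  exact Ideal.span_singleton_eq_span_singleton.mpr (normalize_associated _)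

theorem minPoly_monic (x : ℕ → K) (h : annIdeal x ≠ ⊥) : (minPoly x).Monic := by
  classical
  refine Polynomial.monic_normalize fun h0 => h ?_
  rw [← Ideal.span_singleton_generator (annIdeal x), h0]
  simp

/-- The sequence `x` is a linear recurrence sequence and all its nonzero eigenvalues (the nonzero
roots of its minimal polynomial) are `M`-th roots of unity and have multiplicity at most `2`. -/
def EigenvalueCondition (x : ℕ → ℂ) (M : ℕ) : Prop :=
  (∃ E : LinearRecurrence ℂ, E.IsSolution x) ∧
    ∀ z : ℂ, z ≠ 0 → (minPoly x).IsRoot z →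
      z ^ M = 1 ∧ (minPoly x).rootMultiplicity z ≤ 2

/-- The sequence `(x_{n+M} - x_n)` is ultimately periodic with period `M`. -/
def DifferenceCondition (x : ℕ → ℂ) (M : ℕ) : Prop :=
  ∃ N : ℕ, ∀ n ≥ N, x (n + M + M) - x (n + M) = x (n + M) - x n

end LinSeq

end

/-! ### From vanishing second differences to eigenvalues -/

namespace LinSeq

/-! Let δ_v(m) (`defect`) be U_m minus the value of the length-m prefix of the quasi-greedy
expansion of 1 at the vertex v. That expansion is the greedy block at v with its last digit lowered,
followed by the expansion at σ(v); hence Δ_v is δ_v minus a shifted δ_{σ(v)}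
(`Delta_eq_defect_sub`), and it suffices to control the defects on the orbit of i, which is finite
and closed under σ.

By pumping, the maximal words of lengths m + jY are growing prefixes of one ultimately periodic word
W followed by a fixed suffix (`exists_periodic_maxWord`), so U_{m+jY} is the value of a prefix of W
up to a constant. Dividing by U and passing to the limit, W represents 1 with all tails in [0,1]
(`exists_isTailValue`). Such a word is the quasi-greedy expansion, or leaves it at the end of a
block by completing a greedy expansion and continuing with zeros (`IsTailValue.dichotomy`). So along
each class mod Y the defect is constant, or is another defect, o ≥ 1 positions lower, plus a
constant (`defect_dichotomy`).

Following these links through finitely many classes makes every defect ultimately affine along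
arithmetic progressions of a common step (`exists_common_affine_step`). The second difference of Δ_i
with a suitable step M then vanishes eventually, so X^N (X^M - 1)^2 annihilates Δ_i, which gives
both conditions. -/

theorem exists_linearRecurrence_of_monic {K : Type*} [Field K] {x : ℕ → K} {P : K[X]}
    (hP : P.Monic) (hx : P ∈ annIdeal x) : ∃ E : LinearRecurrence K, E.IsSolution x := by
  refine ⟨⟨P.natDegree, fun k => -P.coeff k⟩, fun n => ?_⟩
  have h := hx n
  rw [Polynomial.sum_over_range _ (by simp), Finset.sum_range_succ, hP.coeff_natDegree,
    one_mul] at h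
  change x (n + P.natDegree) = ∑ i : Fin P.natDegree, -P.coeff i * x (n + i)
  rw [Fin.sum_univ_eq_sum_range (fun k => -P.coeff k * x (n + k))]
  simp only [neg_mul, Finset.sum_neg_distrib]
  exact eq_neg_of_add_eq_zero_right h

theorem annihilator_mem {K : Type*} [Field K] {x : ℕ → K} {N M : ℕ}
    (h : ∀ n ≥ N, x (n + M + M) - x (n + M) = x (n + M) - x n) :
    (X ^ N * (X ^ M - 1) ^ 2 : K[X]) ∈ annIdeal x := by
  have e : (X ^ N * (X ^ M - 1) ^ 2 : K[X]) =
      monomial (N + M + M) 1 + (monomial (N + M) (-2) + monomial N 1) := by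
    simp only [← C_mul_X_pow_eq_monomial, map_neg, map_one, C_ofNat, pow_add]
    ring
  rw [e]
  intro n
  rw [Polynomial.sum_add_index _ _ _ (by simp) (by intros; ring),
    Polynomial.sum_add_index _ _ _ (by simp) (by intros; ring),
    sum_monomial_index _ _ (by simp), sum_monomial_index _ _ (by simp),
    sum_monomial_index _ _ (by simp)]
  have := h (n + N) (Nat.le_add_left _ _)
  simp only [← add_assoc]
  linear_combination this

/-- The minimal polynomial divides X^N (X^M - 1)^2. The factor X^N absorbs the preperiod and only
affects the eigenvalue 0; X^M - 1 is separable, so its square has only double roots. -/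
theorem eigenvalueCondition_of_differenceCondition {x : ℕ → ℂ} {M : ℕ} (hM : 1 ≤ M)
    (h : DifferenceCondition x M) : EigenvalueCondition x M := by
  obtain ⟨N, hN⟩ := h
  have hmem := annihilator_mem hN
  have hM0 : M ≠ 0 := by omega
  have hmonic' : (X ^ M - 1 : ℂ[X]).Monic := by
    simpa using monic_X_pow_sub_C (1 : ℂ) hM0
  have hmonic : (X ^ N * (X ^ M - 1) ^ 2 : ℂ[X]).Monic := (monic_X_pow N).mul (hmonic'.pow 2)
  refine ⟨exists_linearRecurrence_of_monic hmonic hmem, fun z hz hroot => ?_⟩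
  have hdvd : minPoly x ∣ X ^ N * (X ^ M - 1) ^ 2 := by
    rwa [← Ideal.mem_span_singleton, span_minPoly]
  have hzM : z ^ M = 1 := by
    have h0 := hroot.dvd hdvd
    rw [IsRoot.def] at h0
    simpa [hz, sub_eq_zero] using h0
  refine ⟨hzM, (rootMultiplicity_le_rootMultiplicity_of_dvd hmonic.ne_zero hdvd z).trans ?_⟩
  have h1 : rootMultiplicity z (X ^ N : ℂ[X]) = 0 :=
    rootMultiplicity_eq_zero (by simp [hz])
  have hsep : (X ^ M - 1 : ℂ[X]).Separable := by
    simpa using separable_X_pow_sub_C (n := M) (1 : ℂ) (by exact_mod_cast hM0) one_ne_zero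
  have h2 : rootMultiplicity z (X ^ M - 1 : ℂ[X]) ≤ 1 :=
    rootMultiplicity_le_one_of_separable hsep z
  rw [rootMultiplicity_mul hmonic.ne_zero, h1, pow_two,
    rootMultiplicity_mul (mul_ne_zero hmonic'.ne_zero hmonic'.ne_zero)]
  omega

end LinSeq

/-! ### Affine behaviour along residue classes -/

/-- If on each residue class modulo `Y` meeting `A` the sequence `Q` is ultimately constant, or
ultimately differs by a constant from its values on another such class, then `Q` is ultimately
affine along all these classes, for a common step `K`. -/
theorem exists_common_affine_step (Q : ℕ → ℤ) (A : ℕ → Prop) (Y : ℕ) (hY : 1 ≤ Y)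
    (hQ : ∀ a, A (a % Y) → (∃ C : ℤ, ∃ N, ∀ m ≥ N, m ≡ a [MOD Y] → Q m = C) ∨
      ∃ o, 1 ≤ o ∧ ∃ C : ℤ, ∃ N, ∀ m ≥ N, m ≡ a [MOD Y] →
        A ((m - o) % Y) ∧ Q m = Q (m - o) + C) :
    ∃ K, 1 ≤ K ∧ Y ∣ K ∧ ∃ N, ∃ D : ℕ → ℤ, ∀ m ≥ N, A (m % Y) → Q (m + K) = Q m + D (m % Y) := by
  have key : ∀ a, A (a % Y) → ∃ q, 1 ≤ q ∧ Y ∣ q ∧ ∃ D : ℤ, ∃ N, ∀ m ≥ N, m ≡ a [MOD Y] →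
      Q (m + q) = Q m + D := by
    intro a ha
    -- The total offsets reachable from the class of `a` by composing links.
    let S : Set ℕ := {o | ∃ C : ℤ, ∃ N, ∀ m ≥ N, m ≡ a [MOD Y] →
      A ((m - o) % Y) ∧ Q m = Q (m - o) + C}
    by_cases hc : ∃ C : ℤ, ∃ N, ∀ m ≥ N, m ≡ a [MOD Y] → Q m = C
    · obtain ⟨C, N, h⟩ := hc
      refine ⟨Y, hY, dvd_rfl, 0, N, fun m hm hma => ?_⟩
      rw [h m hm hma, h (m + Y) (by omega) (by simpa [Nat.ModEq] using hma), add_zero]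
    have h0 : 0 ∈ S := ⟨0, 0, fun m _ hma => by
      have : m % Y = a % Y := hma
      simpa [this] using ha⟩
    have hstep : ∀ o ∈ S, ∃ o' ∈ S, o < o' := by
      rintro o ⟨C, N, h⟩
      -- `a + o * Y - o` is a representative of the class of `m - o` that avoids truncated
      -- subtraction.
      have hbig : ∀ m, m ≥ N + o + o * Y + a → m ≡ a [MOD Y] →
          m - o ≡ a + o * Y - o [MOD Y] := by
        intro m hm hma
        have hoY : o ≤ o * Y := Nat.le_mul_of_pos_right _ hY
        refine Nat.ModEq.add_right_cancel' o ?_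
        rw [Nat.sub_add_cancel (by omega), Nat.sub_add_cancel (by omega)]
        simpa [Nat.ModEq] using hma
      have hex : (a + Y * (N + o + o * Y + a)) ≥ N + o + o * Y + a :=
        (Nat.le_mul_of_pos_left _ hY).trans (Nat.le_add_left _ _)
      have hA : A ((a + o * Y - o) % Y) := by
        have hma : a + Y * (N + o + o * Y + a) ≡ a [MOD Y] := by simp [Nat.ModEq]
        have := (h _ (by omega) hma).1
        rwa [show (a + Y * (N + o + o * Y + a) - o) % Y = _ from hbig _ hex hma] at this
      rcases hQ _ hA with ⟨C', N', h'⟩ | ⟨o', ho', C', N', h'⟩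
      -- Reaching a constant class would make `Q` ultimately constant on the class of `a`.
      · refine absurd ⟨C' + C, N + o + o * Y + a + N', fun m hm hma => ?_⟩ hc
        rw [(h m (by omega) hma).2, h' (m - o) (by omega) (hbig m (by omega) hma)]
      · refine ⟨o + o', ⟨C' + C, N + o + o * Y + a + N', fun m hm hma => ?_⟩, by omega⟩
        have := h' (m - o) (by omega) (hbig m (by omega) hma)
        rw [Nat.sub_sub] at this
        exact ⟨this.1, by rw [(h m (by omega) hma).2, this.2, add_assoc]⟩
    have hinf : S.Infinite := by
      refine Set.infinite_of_not_bddAbove ?_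
      rintro ⟨b, hb⟩
      have : ∀ n, ∃ o ∈ S, n ≤ o := by
        intro n
        induction n with
        | zero => exact ⟨0, h0, le_rfl⟩
        | succ n ih =>
          obtain ⟨o, ho, hno⟩ := ih
          obtain ⟨o', ho', hoo'⟩ := hstep o ho
          exact ⟨o', ho', by omega⟩
      obtain ⟨o, ho, hbo⟩ := this (b + 1)
      have := hb ho
      omega
    -- Infinitely many offsets share finitely many residues. Two congruent offsets compare `Q m` and
    -- `Q (m + (o₂ - o₁))` with the same value `Q (m - o₁)`, so the increment is `C₂ - C₁`.
    have hpig : ∃ o₁ ∈ S, ∃ o₂ ∈ S, o₁ < o₂ ∧ o₁ % Y = o₂ % Y := by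
      obtain ⟨x, hx, y, hy, hne, hxy⟩ := hinf.exists_ne_map_eq_of_mapsTo
        (f := fun o => o % Y) (t := Set.Iio Y) (fun o _ => Nat.mod_lt o hY) (Set.finite_Iio Y)
      rcases lt_or_gt_of_ne hne with hlt | hlt
      · exact ⟨x, hx, y, hy, hlt, hxy⟩
      · exact ⟨y, hy, x, hx, hlt, hxy.symm⟩
    obtain ⟨o₁, ⟨C₁, N₁, h₁⟩, o₂, ⟨C₂, N₂, h₂⟩, hlt, hmod⟩ := hpig
    have hdvd : Y ∣ o₂ - o₁ := (Nat.modEq_iff_dvd' hlt.le).mp hmod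
    refine ⟨o₂ - o₁, by omega, hdvd, C₂ - C₁, N₁ + N₂ + o₁ + o₂, fun m hm hma => ?_⟩
    have hma' : m + (o₂ - o₁) ≡ a [MOD Y] := by
      obtain ⟨k, hk⟩ := hdvd
      rw [hk]
      simpa [Nat.ModEq] using hma
    have e₁ := (h₁ m (by omega) hma).2
    have e₂ := (h₂ (m + (o₂ - o₁)) (by omega) hma').2
    rw [show m + (o₂ - o₁) - o₂ = m - o₁ by omega] at e₂
    rw [e₁, e₂]
    ring
  choose! q hq1 hqY D N hD using key
  have hmul : ∀ a, A (a % Y) → ∀ k : ℕ, ∀ m ≥ N a, m ≡ a [MOD Y] →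
      Q (m + k * q a) = Q m + k * D a := by
    intro a ha k
    induction k with
    | zero => intro m _ _; simp
    | succ k ih =>
      intro m hm hma
      have hma' : m + k * q a ≡ a [MOD Y] := by
        obtain ⟨c, hc⟩ := (hqY a ha).mul_left k
        rw [hc]
        simpa [Nat.ModEq] using hma
      have := hD a ha (m + k * q a) (by omega) hma'
      rw [show m + (k + 1) * q a = m + k * q a + q a by ring, this, ih m hm hma]
      push_cast
      ring
  classical
  -- The value 1 on classes outside `A` keeps the product of the steps positive.
  let q' : ℕ → ℕ := fun a => if A (a % Y) then q a else 1
  have hq' : ∀ a, 1 ≤ q' a := fun a => by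
    by_cases h : A (a % Y)
    · simpa [q', h] using hq1 a h
    · simp [q', h]
  refine ⟨Y * ∏ a ∈ Finset.range Y, q' a, ?_, Dvd.intro _ rfl, ∑ a ∈ Finset.range Y, N a,
    fun a => ((Y * ∏ a ∈ Finset.range Y, q' a) / q a : ℕ) * D a, fun m hm hAm => ?_⟩
  · exact Nat.mul_pos hY (Finset.prod_pos fun a _ => hq' a)
  · have hmem : m % Y ∈ Finset.range Y := Finset.mem_range.mpr (Nat.mod_lt m hY)
    have hA' : A (m % Y % Y) := by simpa using hAm
    have hdvd : q (m % Y) ∣ Y * ∏ a ∈ Finset.range Y, q' a := by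
      have := Finset.dvd_prod_of_mem q' hmem
      simp only [q', if_pos hA'] at this
      exact this.mul_left Y
    have hNm : m ≥ N (m % Y) :=
      (Finset.single_le_sum (f := N) (fun _ _ => Nat.zero_le _) hmem).trans hm
    have := hmul (m % Y) hA' ((Y * ∏ a ∈ Finset.range Y, q' a) / q (m % Y)) m hNm
      (Nat.mod_modEq m Y).symm
    rwa [Nat.div_mul_cancel hdvd] at this

namespace NumSys

variable {p : ℕ} [NeZero p]

theorem ofNat_val_add (v n : ℕ) :
    Fin.ofNat p ((Fin.ofNat p v : Fin p) + n) = Fin.ofNat p (v + n) := by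
  ext
  simp [Fin.ofNat]

/-- The total version of the successor map `σ`. -/
noncomputable def next (β : Fin p → ℝ) (v : Fin p) : Fin p := Fin.ofNat p ((v : ℕ) + len β v)

/-! ### Greedy expansions of `1` in alternate bases -/

theorem remainder_nonneg (β : Fin p → ℝ) (v : Fin p) (n : ℕ) : 0 ≤ remainder β v n := by
  cases n with
  | zero => simp [remainder]
  | succ n => exact Int.fract_nonneg _

theorem mul_remainder {β : Fin p → ℝ} (hβ : ∀ v, 1 ≤ β v) (v : Fin p) (n : ℕ) :
    β (Fin.ofNat p ((v : ℕ) + n)) * remainder β v n =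
      digit β v n + remainder β v (n + 1) := by
  have h : 0 ≤ β (Fin.ofNat p ((v : ℕ) + n)) * remainder β v n :=
    mul_nonneg (zero_le_one.trans (hβ _)) (remainder_nonneg β v n)
  rw [digit, natCast_floor_eq_intCast_floor h, remainder, Int.floor_add_fract]

theorem digit_of_len_le {β : Fin p → ℝ} {v : Fin p} (hfin : IsFiniteExp β v) {n : ℕ}
    (hn : len β v ≤ n) : digit β v n = 0 :=
  Nat.sInf_mem (s := {N : ℕ | ∀ n ≥ N, digit β v n = 0}) hfin n hn

theorem one_le_len {β : Fin p → ℝ} (hβ : ∀ v, 1 ≤ β v) {v : Fin p} (hfin : IsFiniteExp β v) :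
    1 ≤ len β v := by
  by_contra h
  have h0 : digit β v 0 = 0 := digit_of_len_le hfin (by omega)
  have h1 : 1 ≤ digit β v 0 := by
    rw [digit, Nat.one_le_floor_iff]
    simpa [remainder] using hβ _
  omega

theorem one_le_digit_len_sub_one {β : Fin p → ℝ} (hβ : ∀ v, 1 ≤ β v) {v : Fin p}
    (hfin : IsFiniteExp β v) : 1 ≤ digit β v (len β v - 1) := by
  have h1 := one_le_len hβ hfin
  by_contra h
  have hle : len β v ≤ len β v - 1 := by
    refine Nat.sInf_le fun n hn => ?_
    rcases eq_or_lt_of_le hn with rfl | hlt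
    · omega
    · exact digit_of_len_le hfin (by omega)
  omega

theorem remainder_pos {β : Fin p → ℝ} {v : Fin p} {n : ℕ} (hn : n < len β v) :
    0 < remainder β v n := by
  refine lt_of_le_of_ne (remainder_nonneg β v n) fun h => ?_
  have hz : ∀ k, remainder β v (n + k) = 0 := by
    intro k
    induction k with
    | zero => exact h.symm
    | succ k ih => rw [← add_assoc, remainder, ih]; simp
  have : len β v ≤ n := by
    refine Nat.sInf_le fun k hk => ?_
    obtain ⟨j, rfl⟩ := Nat.exists_eq_add_of_le hk
    rw [digit, hz]
    simp
  omega

/-- Zero digits alone do not say that the remainder is zero. Once they vanish, each step multiplies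
the remainder by some β ≥ 1; if some `β u` exceeds 1, it occurs once per period, and a positive
remainder would outgrow the bound 1. If all β equal 1, the remainder is 0 after one step. -/
theorem remainder_len {β : Fin p → ℝ} (hβ : ∀ v, 1 ≤ β v) {v : Fin p}
    (hfin : IsFiniteExp β v) : remainder β v (len β v) = 0 := by
  have hl := one_le_len hβ hfin
  by_cases hall : ∀ u, β u = 1
  · have hz : ∀ n, remainder β v (n + 1) = 0 := by
      intro n
      induction n with
      | zero => simp [remainder, hall]
      | succ n ih => rw [remainder, ih]; simp
    rw [← Nat.sub_add_cancel hl]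
    exact hz _
  push Not at hall
  obtain ⟨u, hu⟩ := hall
  have hu1 : 1 < β u := lt_of_le_of_ne (hβ u) hu.symm
  by_contra hne
  have hpos : 0 < remainder β v (len β v) :=
    lt_of_le_of_ne (remainder_nonneg β v _) (Ne.symm hne)
  have hstep : ∀ n, len β v ≤ n → remainder β v (n + 1) =
      β (Fin.ofNat p ((v : ℕ) + n)) * remainder β v n := fun n hn => by
    rw [mul_remainder hβ, digit_of_len_le hfin hn]
    simp
  have hmono : ∀ n, len β v ≤ n → ∀ k, remainder β v n ≤ remainder β v (n + k) := by
    intro n hn k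
    induction k with
    | zero => exact le_rfl
    | succ k ih =>
      rw [← add_assoc, hstep _ (by omega)]
      exact ih.trans (le_mul_of_one_le_left (remainder_nonneg β v _) (hβ _))
  have hperiod : ∀ n, len β v ≤ n → β u * remainder β v n ≤ remainder β v (n + p) := by
    intro n hn
    have hp : 0 < p := NeZero.pos p
    have hv := v.2
    obtain ⟨k, hk, hku⟩ : ∃ k < p, Fin.ofNat p ((v : ℕ) + (n + k)) = u := by
      refine ⟨(u + (p * (v + n) - (v + n))) % p, Nat.mod_lt _ hp, ?_⟩
      ext
      have hle : (v : ℕ) + n ≤ p * (v + n) := Nat.le_mul_of_pos_left _ hp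
      change (v + (n + (u + (p * (v + n) - (v + n))) % p)) % p = (u : ℕ)
      rw [← add_assoc, Nat.add_mod_mod,
        show v + n + (u + (p * (v + n) - (v + n))) = (u : ℕ) + p * (v + n) by omega,
        Nat.add_mul_mod_self_left, Nat.mod_eq_of_lt u.2]
    calc β u * remainder β v n ≤ β u * remainder β v (n + k) :=
          mul_le_mul_of_nonneg_left (hmono n hn k) (by linarith)
      _ = remainder β v (n + k + 1) := by rw [hstep _ (by omega), ← hku]
      _ ≤ remainder β v (n + k + 1 + (p - (k + 1))) := hmono _ (by omega) _
      _ = remainder β v (n + p) := by congr 1; omega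
  have hpow : ∀ k : ℕ, β u ^ k * remainder β v (len β v) ≤ remainder β v (len β v + k * p) := by
    intro k
    induction k with
    | zero => simp
    | succ k ih =>
      rw [show len β v + (k + 1) * p = len β v + k * p + p by ring]
      refine le_trans ?_ (hperiod _ (by omega))
      rw [pow_succ', mul_assoc]
      exact mul_le_mul_of_nonneg_left ih (by linarith)
  obtain ⟨k, hk⟩ := pow_unbounded_of_one_lt (1 / remainder β v (len β v)) hu1
  rw [div_lt_iff₀ hpos] at hk
  have hlt : remainder β v (len β v + k * p) < 1 := by
    rw [show len β v + k * p = len β v + k * p - 1 + 1 by omega]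
    exact Int.fract_lt_one _
  linarith [hpow k]

/-! ### Quasi-greedy expansions -/

/-- The quasi-greedy expansion of `1` from the vertex `v`: the last nonzero digit of each finite
greedy expansion is lowered by `1` and followed by the expansion of the next vertex. -/
noncomputable def quasiDigit (β : Fin p → ℝ) (v : Fin p) (d : ℕ) : ℕ :=
  if d < len β v then digit β v d - (if d + 1 = len β v then 1 else 0)
  -- Positivity of the length makes the recursion terminate; `len` defaults to 0 for an infinite
  -- expansion.
  else if 0 < len β v ∧ len β v ≤ d then quasiDigit β (next β v) (d - len β v)
  else 0
termination_by d
decreasing_by omega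

/-- The value of the prefix of length `m` of the infinite word `f`. -/
def prefixVal (U f : ℕ → ℕ) (m : ℕ) : ℤ :=
  ∑ d ∈ Finset.range m, (f d : ℤ) * U (m - 1 - d)

theorem prefixVal_add (U f : ℕ → ℕ) (a k : ℕ) :
    prefixVal U f (a + k) = (∑ d ∈ Finset.range a, (f d : ℤ) * U (a + k - 1 - d)) +
      prefixVal U (fun d => f (a + d)) k := by
  rw [prefixVal, Finset.sum_range_add, prefixVal]
  congr 1
  refine Finset.sum_congr rfl fun d _ => ?_
  congr 3
  omega

theorem prefixVal_eq_zero (U : ℕ → ℕ) {f : ℕ → ℕ} (hf : ∀ d, f d = 0) (m : ℕ) :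
    prefixVal U f m = 0 := by
  simp [prefixVal, hf]

/-- The term `- U k` is the lowered last digit of the block, whose weight is `U k`. -/
theorem prefixVal_quasiDigit {β : Fin p → ℝ} (hβ : ∀ v, 1 ≤ β v) (U : ℕ → ℕ) {v : Fin p}
    (hfin : IsFiniteExp β v) (k : ℕ) :
    prefixVal U (quasiDigit β v) (len β v + k) =
      (∑ d ∈ Finset.range (len β v), (digit β v d : ℤ) * U (len β v + k - 1 - d)) - U k +
        prefixVal U (quasiDigit β (next β v)) k := by
  have hl := one_le_len hβ hfin
  have hd := one_le_digit_len_sub_one hβ hfin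
  rw [prefixVal_add]
  have e1 : (fun d => quasiDigit β v (len β v + d)) = quasiDigit β (next β v) := by
    funext d
    rw [quasiDigit, if_neg (by omega), if_pos (by omega), Nat.add_sub_cancel_left]
  rw [e1]
  congr 1
  obtain ⟨l, hle⟩ : ∃ l, len β v = l + 1 := ⟨len β v - 1, by omega⟩
  rw [hle] at hd ⊢
  rw [Finset.sum_range_succ, Finset.sum_range_succ, add_sub_assoc]
  congr 1
  · refine Finset.sum_congr rfl fun d hdl => ?_
    have := Finset.mem_range.mp hdl
    rw [quasiDigit, if_pos (by omega), if_neg (by omega), Nat.sub_zero]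
  · rw [quasiDigit, if_pos (by omega), if_pos hle.symm, show l + 1 + k - 1 - l = k by omega]
    simp only [Nat.add_sub_cancel] at hd
    push_cast [Nat.cast_sub hd]
    ring

/-- `W` is a word whose tails, read from position `v` on, have values `ρ d ∈ [0, 1]`. -/
structure IsTailValue (β : Fin p → ℝ) (v : Fin p) (W : ℕ → ℕ) (ρ : ℕ → ℝ) : Prop where
  nonneg : ∀ d, 0 ≤ ρ d
  le_one : ∀ d, ρ d ≤ 1
  step : ∀ d, ρ (d + 1) = β (Fin.ofNat p ((v : ℕ) + d)) * ρ d - W d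

theorem IsTailValue.shift {β : Fin p → ℝ} {v : Fin p} {W : ℕ → ℕ} {ρ : ℕ → ℝ}
    (h : IsTailValue β v W ρ) (k : ℕ) :
    IsTailValue β (Fin.ofNat p ((v : ℕ) + k)) (fun d => W (k + d)) (fun d => ρ (k + d)) where
  nonneg d := h.nonneg _
  le_one d := h.le_one _
  step d := by
    have := h.step (k + d)
    rw [ofNat_val_add]
    simpa [add_assoc] using this

theorem IsTailValue.eq_zero {β : Fin p → ℝ} {v : Fin p} {W : ℕ → ℕ} {ρ : ℕ → ℝ}
    (h : IsTailValue β v W ρ) (h0 : ρ 0 = 0) (d : ℕ) : W d = 0 := by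
  have key : ∀ d, ρ d = 0 := by
    intro d
    induction d with
    | zero => exact h0
    | succ d ih =>
      have h1 := h.step d
      rw [ih, mul_zero] at h1
      have h2 := h.nonneg (d + 1)
      have h3 : (0 : ℝ) ≤ W d := Nat.cast_nonneg _
      linarith
  have h1 := h.step d
  rw [key, key, mul_zero] at h1
  have : (W d : ℝ) = 0 := by linarith
  exact_mod_cast this

/-- Digits are forced as long as the greedy remainder `y` lies strictly between 0 and 1. At `y = 0`
uniqueness fails, and this is the only source of branching. -/
theorem eq_of_cast_add_eq {a b : ℕ} {x y : ℝ} (h : (a : ℝ) + x = b + y) (hx0 : 0 ≤ x)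
    (hx1 : x ≤ 1) (hy0 : 0 < y) (hy1 : y < 1) : a = b ∧ x = y := by
  have h1 : (a : ℝ) < b + 1 := by linarith
  have h2 : (b : ℝ) < a + 1 := by linarith
  have h1' : a < b + 1 := by exact_mod_cast h1
  have h2' : b < a + 1 := by exact_mod_cast h2
  have hab : a = b := by omega
  subst hab
  exact ⟨rfl, by linarith⟩

theorem IsTailValue.prefix_eq {β : Fin p → ℝ} (hβ : ∀ v, 1 ≤ β v) {v : Fin p} {W : ℕ → ℕ}
    {ρ : ℕ → ℝ} (h : IsTailValue β v W ρ) (h0 : ρ 0 = 1) :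
    ∀ d < len β v, ρ d = remainder β v d ∧ (d + 1 < len β v → W d = digit β v d) := by
  intro d
  have aux : ∀ d, d + 1 < len β v → ρ d = remainder β v d →
      W d = digit β v d ∧ ρ (d + 1) = remainder β v (d + 1) := fun d hd hr => by
    have h1 := h.step d
    rw [hr, mul_remainder hβ] at h1
    exact eq_of_cast_add_eq (by linarith) (h.nonneg _) (h.le_one _) (remainder_pos hd)
      (Int.fract_lt_one _)
  have hρ : d < len β v → ρ d = remainder β v d := by
    induction d with
    | zero => intro _; rw [h0, remainder]
    | succ d ih => exact fun hd => (aux d hd (ih (by omega))).2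
  exact fun hd => ⟨hρ hd, fun hd' => (aux d hd' (hρ hd)).1⟩

/-- The greedy remainder is 0 after the block, so the last digit of `W` plus a tail in [0,1] equals
an integer: the tail is 0, or it is 1 and the digit is one less. -/
theorem IsTailValue.at_len {β : Fin p → ℝ} (hβ : ∀ v, 1 ≤ β v) {v : Fin p} {W : ℕ → ℕ}
    {ρ : ℕ → ℝ} (h : IsTailValue β v W ρ) (h0 : ρ 0 = 1) (hfin : IsFiniteExp β v) :
    (W (len β v - 1) = digit β v (len β v - 1) ∧ ρ (len β v) = 0) ∨
      (W (len β v - 1) + 1 = digit β v (len β v - 1) ∧ ρ (len β v) = 1) := by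
  have hl := one_le_len hβ hfin
  have h1 := h.step (len β v - 1)
  rw [(h.prefix_eq hβ h0 (len β v - 1) (by omega)).1, mul_remainder hβ,
    Nat.sub_add_cancel hl, remainder_len hβ hfin] at h1
  have hn := h.nonneg (len β v)
  have hle := h.le_one (len β v)
  have a1 : W (len β v - 1) ≤ digit β v (len β v - 1) := by
    have : (W (len β v - 1) : ℝ) ≤ digit β v (len β v - 1) := by linarith
    exact_mod_cast this
  have a2 : digit β v (len β v - 1) ≤ W (len β v - 1) + 1 := by
    have : (digit β v (len β v - 1) : ℝ) ≤ W (len β v - 1) + 1 := by linarith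
    exact_mod_cast this
  rcases Nat.eq_or_lt_of_le a1 with he | hlt
  · left
    rw [he] at h1
    exact ⟨he, by linarith⟩
  · right
    have he : W (len β v - 1) + 1 = digit β v (len β v - 1) := by omega
    rw [← he] at h1
    push_cast at h1
    exact ⟨he, by linarith⟩

/-- The limit word of maximal words is the quasi-greedy expansion, or leaves it by finishing
with a finite greedy expansion. -/
theorem IsTailValue.dichotomy {β : Fin p → ℝ} (hβ : ∀ v, 1 ≤ β v) (V : Set (Fin p))
    (hV : ∀ v ∈ V, IsFiniteExp β v ∧ next β v ∈ V) (U : ℕ → ℕ) {v : Fin p} (hv : v ∈ V)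
    {W : ℕ → ℕ} {ρ : ℕ → ℝ} (h : IsTailValue β v W ρ) (h0 : ρ 0 = 1) :
    (∀ d, W d = quasiDigit β v d) ∨
      ∃ o, 1 ≤ o ∧ ∃ u ∈ V, u = Fin.ofNat p ((v : ℕ) + o) ∧ ∀ k,
        prefixVal U W (o + k) = prefixVal U (quasiDigit β v) (o + k) + U k -
          prefixVal U (quasiDigit β u) k := by
  -- The second alternative does not involve `n`: if it fails, agreement on all finite prefixes
  -- gives equality of the words. The induction removes one block at a time.
  suffices hn : ∀ n : ℕ, ∀ v ∈ V, ∀ W ρ, IsTailValue β v W ρ → ρ 0 = 1 →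
      (∀ d < n, W d = quasiDigit β v d) ∨
      ∃ o, 1 ≤ o ∧ ∃ u ∈ V, u = Fin.ofNat p ((v : ℕ) + o) ∧ ∀ k,
        prefixVal U W (o + k) = prefixVal U (quasiDigit β v) (o + k) + U k -
          prefixVal U (quasiDigit β u) k by
    by_cases hc : ∃ o, 1 ≤ o ∧ ∃ u ∈ V, u = Fin.ofNat p ((v : ℕ) + o) ∧ ∀ k,
        prefixVal U W (o + k) = prefixVal U (quasiDigit β v) (o + k) + U k -
          prefixVal U (quasiDigit β u) k
    · exact Or.inr hc
    · exact Or.inl fun d => ((hn (d + 1) v hv W ρ h h0).resolve_right hc) d (Nat.lt_succ_self d)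
  intro n
  induction n using Nat.strong_induction_on with
  | _ n ih =>
    intro v hv W ρ h h0
    obtain ⟨hfin, hnext⟩ := hV v hv
    have hl := one_le_len hβ hfin
    have hpre := h.prefix_eq hβ h0
    obtain ⟨l, hle⟩ : ∃ l, len β v = l + 1 := ⟨len β v - 1, by omega⟩
    rcases h.at_len hβ h0 hfin with ⟨hW, hρ⟩ | ⟨hW, hρ⟩
    · refine Or.inr ⟨len β v, hl, next β v, hnext, rfl, fun k => ?_⟩
      rw [prefixVal_add, prefixVal_quasiDigit hβ U hfin,
        prefixVal_eq_zero U (fun d => (h.shift (len β v)).eq_zero (by simpa using hρ) d)]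
      have : ∑ d ∈ Finset.range (len β v), (W d : ℤ) * U (len β v + k - 1 - d) =
          ∑ d ∈ Finset.range (len β v), (digit β v d : ℤ) * U (len β v + k - 1 - d) := by
        refine Finset.sum_congr rfl fun d hd => ?_
        have hd' := Finset.mem_range.mp hd
        rcases Nat.eq_or_lt_of_le (Nat.succ_le_of_lt hd') with he | hlt
        · rw [show d = len β v - 1 by omega, hW]
        · rw [(hpre d hd').2 hlt]
      rw [this]
      ring
    · have hagree : ∀ d < len β v, W d = quasiDigit β v d := fun d hd => by
        rw [quasiDigit, if_pos hd]
        split_ifs with he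
        · rw [← Nat.add_sub_cancel (n := d) (m := 1), he]; omega
        · rw [(hpre d hd).2 (by omega), Nat.sub_zero]
      have hq : ∀ d, quasiDigit β v (len β v + d) = quasiDigit β (next β v) d := fun d => by
        rw [quasiDigit, if_neg (by omega), if_pos (by omega), Nat.add_sub_cancel_left]
      rcases Nat.eq_zero_or_pos n with rfl | hn
      · exact Or.inl fun d hd => absurd hd (by omega)
      rcases ih (n - len β v) (by omega) (next β v) hnext _ _ (h.shift (len β v))
        (by simpa using hρ) with hA | ⟨o, ho, u, huV, hu, hval⟩
      · refine Or.inl fun d hd => ?_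
        by_cases hdl : d < len β v
        · exact hagree d hdl
        · obtain ⟨e, rfl⟩ := Nat.exists_eq_add_of_le (not_lt.mp hdl)
          rw [hA e (by omega), hq]
      · refine Or.inr ⟨len β v + o, by omega, u, huV, ?_, fun k => ?_⟩
        · rw [hu, next, ofNat_val_add, add_assoc]
        · rw [add_assoc, prefixVal_add, hval, prefixVal_add U (quasiDigit β v)]
          simp only [hq]
          rw [Finset.sum_congr rfl fun d hd => by rw [hagree d (Finset.mem_range.mp hd)]]
          ring

/-! ### Greedy words -/

/-- The value of a word, most significant digit first. -/
def listVal (U : ℕ → ℕ) : List ℕ → ℕ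
  | [] => 0
  | a :: l => a * U l.length + listVal U l

/-- The greedy representation of `U m - 1`, the maximal word of length `m`. -/
def maxWord (U : ℕ → ℕ) (m : ℕ) : List ℕ := greedyDigits U m (U m - 1)

theorem length_greedyDigits (U : ℕ → ℕ) (m x : ℕ) : (greedyDigits U m x).length = m := by
  induction m generalizing x with
  | zero => rfl
  | succ m ih => simp [greedyDigits, ih]

theorem length_maxWord (U : ℕ → ℕ) (m : ℕ) : (maxWord U m).length = m :=
  length_greedyDigits U m _

theorem IsPositional.pos {U : ℕ → ℕ} (hU : IsPositional U) (m : ℕ) : 0 < U m := by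
  have := hU.strictMono.monotone (Nat.zero_le m)
  rw [hU.zero] at this
  omega

theorem listVal_greedyDigits {U : ℕ → ℕ} (hU : IsPositional U) {m x : ℕ} (hx : x < U m) :
    listVal U (greedyDigits U m x) = x := by
  induction m generalizing x with
  | zero =>
    rw [hU.zero] at hx
    simp [greedyDigits, listVal]
    omega
  | succ m ih =>
    rw [greedyDigits, listVal, length_greedyDigits, ih (Nat.mod_lt _ (hU.pos m))]
    exact Nat.div_add_mod' x (U m)

theorem listVal_drop_greedyDigits_lt {U : ℕ → ℕ} (hU : IsPositional U) {m x d : ℕ}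
    (hx : x < U m) (hd : d ≤ m) : listVal U ((greedyDigits U m x).drop d) < U (m - d) := by
  induction m generalizing x d with
  | zero =>
    obtain rfl : d = 0 := by omega
    simpa [listVal_greedyDigits hU hx] using hx
  | succ m ih =>
    cases d with
    | zero => simpa [listVal_greedyDigits hU hx] using hx
    | succ d =>
      rw [greedyDigits, List.drop_succ_cons, Nat.add_sub_add_right]
      exact ih (Nat.mod_lt _ (hU.pos m)) (by omega)

theorem sub_one_lt {U : ℕ → ℕ} (hU : IsPositional U) (m : ℕ) : U m - 1 < U m :=
  Nat.sub_lt (hU.pos m) one_pos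

theorem listVal_maxWord {U : ℕ → ℕ} (hU : IsPositional U) (m : ℕ) :
    listVal U (maxWord U m) = U m - 1 :=
  listVal_greedyDigits hU (sub_one_lt hU m)

theorem rep_sub_one {U : ℕ → ℕ} (hU : IsPositional U) (m : ℕ) :
    rep U (U m - 1) = maxWord U m := by
  have h : sInf {l : ℕ | U m - 1 < U l} = m := by
    refine le_antisymm (Nat.sInf_le (sub_one_lt hU m)) ?_
    refine le_csInf ⟨m, sub_one_lt hU m⟩ fun l hl => ?_
    by_contra hlt
    have := hU.strictMono (not_le.mp hlt)
    have hl' : U m - 1 < U l := hl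
    omega
  rw [rep, h, maxWord]

theorem listVal_map_range_append (U W : ℕ → ℕ) (n : ℕ) (z : List ℕ) :
    listVal U ((List.range n).map W ++ z) =
      ∑ d ∈ Finset.range n, W d * U (n + z.length - 1 - d) + listVal U z := by
  induction n generalizing W with
  | zero => simp
  | succ n ih =>
    rw [List.range_succ_eq_map, List.map_cons, List.map_map, List.cons_append, listVal, ih,
      Finset.sum_range_succ']
    simp only [List.length_append, List.length_map, List.length_range, Function.comp_apply]
    have h1 : ∑ d ∈ Finset.range n, W (d + 1) * U (n + 1 + z.length - 1 - (d + 1)) =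
        ∑ d ∈ Finset.range n, W (d + 1) * U (n + z.length - 1 - d) := by
      refine Finset.sum_congr rfl fun d _ => ?_
      congr 2
      omega
    rw [h1, show n + 1 + z.length - 1 - 0 = n + z.length by omega]
    simp only [Nat.succ_eq_add_one]
    ring

/-! ### Pumping -/

theorem length_flatten_replicate (b : List ℕ) (k : ℕ) :
    (List.replicate k b).flatten.length = k * b.length := by
  simp

/-- The infinite word `x y y y ⋯`. -/
def periodicWord (x y : List ℕ) (d : ℕ) : ℕ :=
  if d < x.length then x.getD d 0 else y.getD ((d - x.length) % y.length) 0

theorem map_getD_range (x : List ℕ) : (List.range x.length).map (fun d => x.getD d 0) = x := by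
  refine List.ext_getElem (by simp) fun i h1 h2 => ?_
  simp [h2]

theorem map_periodicWord (x y : List ℕ) (j : ℕ) :
    (List.range (x.length + j * y.length)).map (periodicWord x y) =
      x ++ (List.replicate j y).flatten := by
  induction j with
  | zero =>
    simp only [zero_mul, add_zero, List.replicate_zero, List.flatten_nil, List.append_nil]
    conv_rhs => rw [← map_getD_range x]
    refine List.map_congr_left fun d hd => ?_
    rw [periodicWord, if_pos (List.mem_range.mp hd)]
  | succ j ih =>
    rw [add_mul, one_mul, ← add_assoc, List.range_add, List.map_append, ih,
      List.replicate_succ', List.flatten_append, List.append_assoc]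
    congr 2
    conv_rhs => rw [List.flatten_singleton, ← map_getD_range y]
    rw [List.map_map]
    refine List.map_congr_left fun d hd => ?_
    have hd' := List.mem_range.mp hd
    rw [Function.comp_apply, periodicWord, if_neg (by omega),
      show x.length + j * y.length + d - x.length = d + j * y.length by omega,
      Nat.add_mul_mod_self_right, Nat.mod_eq_of_lt hd']

theorem flatten_replicate_mul (b : List ℕ) (j e : ℕ) :
    (List.replicate j (List.replicate e b).flatten).flatten =
      (List.replicate (j * e) b).flatten := by
  induction j with
  | zero => simp
  | succ j ih =>
    rw [List.replicate_succ, List.flatten_cons, ih, ← List.flatten_append,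
      List.replicate_append_replicate]
    congr 2
    ring

/-- Along an arithmetic progression, the maximal words have the form `x yʲ z`. -/
theorem exists_periodic_maxWord {U : ℕ → ℕ} (hU : IsPositional U) {p : ℕ} (v : Fin p)
    (hreg : (maxLang U p v).IsRegular) :
    ∃ N, ∀ Y, 1 ≤ Y → (∀ k, 1 ≤ k → k ≤ N → k ∣ Y) → ∀ m ≥ N, 1 ≤ m → p ∣ (v : ℕ) + m →
      ∃ (W : ℕ → ℕ) (z : List ℕ) (h : ℕ), m = h + z.length ∧ (∀ d ≥ h, W (d + Y) = W d) ∧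
        ∀ j, maxWord U (m + j * Y) = (List.range (h + j * Y)).map W ++ z := by
  obtain ⟨S, hS, M, hM⟩ := hreg
  refine ⟨Fintype.card S, fun Y hY hdiv m hm hm1 hpm => ?_⟩
  have hmem : maxWord U m ∈ M.accepts := by
    rw [hM]
    obtain ⟨n, hn⟩ := hpm
    refine ⟨n, Nat.pos_of_ne_zero ?_, ?_⟩
    · rintro rfl
      omega
    · rw [show n * p - (v : ℕ) = m by rw [mul_comm, ← hn]; omega, rep_sub_one hU]
  obtain ⟨a, b, c, hw, hlen, hb, hpump⟩ := M.pumping_lemma hmem (by rwa [length_maxWord])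
  have hb1 : 1 ≤ b.length := List.length_pos_iff.mpr hb
  obtain ⟨e, he⟩ := hdiv b.length hb1 (by omega)
  have hylen : (List.replicate e b).flatten.length = Y := by
    rw [length_flatten_replicate, he, mul_comm]
  have hwlen : a.length + b.length + c.length = m := by
    have := congrArg List.length hw
    simp only [List.length_append, length_maxWord] at this
    exact this.symm
  -- The language contains only maximal words, and these are determined by their lengths, so pumping
  -- produces the maximal word of the new length.
  have hword : ∀ k, maxWord U (a.length + k * b.length + c.length) =
      a ++ (List.replicate k b).flatten ++ c := by
    intro k
    have hk : a ++ (List.replicate k b).flatten ++ c ∈ maxLang U p v := by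
      rw [← hM]
      apply hpump
      refine Language.append_mem_mul (Language.append_mem_mul rfl ?_) rfl
      rw [Language.mem_kstar]
      exact ⟨_, rfl, fun y hy => List.eq_of_mem_replicate hy⟩
    obtain ⟨n, -, hn⟩ := hk
    rw [rep_sub_one hU] at hn
    have hl := congrArg List.length hn
    simp only [List.length_append, length_flatten_replicate, length_maxWord] at hl
    rw [hl, hn]
  -- The period is `b` repeated `e` times, of length `Y`. One copy of `b` goes into the suffix, so
  -- that `j = 0` gives the original word `a b c`.
  refine ⟨periodicWord a (List.replicate e b).flatten, b ++ c, a.length, ?_, fun d hd => ?_,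
    fun j => ?_⟩
  · rw [List.length_append]
    omega
  · rw [periodicWord, periodicWord, if_neg (by omega), if_neg (by omega), hylen,
      Nat.sub_add_comm hd, Nat.add_mod_right]
  · rw [← hylen, map_periodicWord, flatten_replicate_mul, hylen,
      show m + j * Y = a.length + (j * e + 1) * b.length + c.length by
        rw [← hwlen, he]; ring, hword, List.replicate_succ', List.flatten_append]
    simp

/-! ### Limit words -/

/-- The indices `m + j * Y - d` have the form np - u with u = v + d mod p. -/
theorem tendsto_ratio {U : ℕ → ℕ} {p : ℕ} [NeZero p] {β : Fin p → ℝ}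
    (hβ : IsAssociatedBase U β) {v : Fin p} {m Y : ℕ} (hY : 1 ≤ Y) (hpY : p ∣ Y)
    (hm : p ∣ (v : ℕ) + m) (d : ℕ) :
    Tendsto (fun j : ℕ => (U (m + j * Y - d) : ℝ) / U (m + j * Y - (d + 1))) atTop
      (𝓝 (β (Fin.ofNat p ((v : ℕ) + d)))) := by
  have hp : 0 < p := NeZero.pos p
  set u : Fin p := Fin.ofNat p ((v : ℕ) + d) with hu
  have hjY : ∀ j, j ≤ j * Y := fun j => Nat.le_mul_of_pos_right _ hY
  have hn : Tendsto (fun j : ℕ => (m + j * Y - d + u) / p) atTop atTop := by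
    refine tendsto_atTop.mpr fun b => eventually_atTop.mpr ⟨b * p + d, fun j hj => ?_⟩
    rw [Nat.le_div_iff_mul_le hp]
    have := hjY j
    omega
  refine ((hβ u).comp hn).congr' (eventually_atTop.mpr ⟨d, fun j hj => ?_⟩)
  have hle := hjY j
  have hdvd : p ∣ m + j * Y - d + u := by
    have h1 : ((v : ℕ) + d) ≡ u [MOD p] := (Nat.mod_modEq _ _).symm
    have h2 : m + j * Y - d + u ≡ m + j * Y - d + (v + d) [MOD p] := h1.symm.add_left _
    rw [show m + j * Y - d + (v + d) = v + m + j * Y by omega] at h2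
    exact (h2.dvd_iff dvd_rfl).mpr (dvd_add hm (hpY.mul_left j))
  simp only [Function.comp_apply]
  rw [Nat.div_mul_cancel hdvd, Nat.add_sub_cancel, Nat.sub_sub]

theorem one_le_base {U : ℕ → ℕ} (hU : IsPositional U) {p : ℕ} {β : Fin p → ℝ}
    (hβ : IsAssociatedBase U β) (v : Fin p) : 1 ≤ β v := by
  refine ge_of_tendsto' (hβ v) fun n => ?_
  rw [one_le_div (by exact_mod_cast hU.pos _)]
  exact_mod_cast hU.strictMono.monotone (Nat.sub_le _ _)

/-- The tail value `ρ d` is the limit of the value of the maximal word without its first `d`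
letters, divided by `U` at the remaining length. Greediness bounds these quotients by 1, and (U_m -
1)/U_m → 1 gives `ρ 0 = 1`. -/
theorem exists_isTailValue {U : ℕ → ℕ} (hU : IsPositional U) {p : ℕ} [NeZero p]
    {β : Fin p → ℝ} (hβ : IsAssociatedBase U β) {v : Fin p} {m Y : ℕ} (hY : 1 ≤ Y)
    (hpY : p ∣ Y) (hm : p ∣ (v : ℕ) + m) {W : ℕ → ℕ}
    (hW : ∀ d, ∀ᶠ j in atTop, ∃ hd : d < (maxWord U (m + j * Y)).length,
      (maxWord U (m + j * Y))[d] = W d) :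
    ∃ ρ, IsTailValue β v W ρ ∧ ρ 0 = 1 := by
  let ρ : ℕ → ℝ := fun d =>
    Nat.rec 1 (fun d r => β (Fin.ofNat p ((v : ℕ) + d)) * r - W d) d
  let T : ℕ → ℕ → ℝ := fun d j =>
    (listVal U ((maxWord U (m + j * Y)).drop d) : ℝ) / U (m + j * Y - d)
  have hUpos : ∀ k, (0 : ℝ) < U k := fun k => by exact_mod_cast hU.pos k
  have hjY : ∀ j, j ≤ j * Y := fun j => Nat.le_mul_of_pos_right _ hY
  have hlim : ∀ d, Tendsto (T d) atTop (𝓝 (ρ d)) := by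
    intro d
    induction d with
    | zero =>
      have h1 : Tendsto (fun j : ℕ => (U (m + j * Y) : ℝ)) atTop atTop := by
        refine tendsto_natCast_atTop_atTop.comp (hU.strictMono.tendsto_atTop.comp ?_)
        exact tendsto_atTop_mono (fun j => (hjY j).trans (Nat.le_add_left _ _)) tendsto_id
      have h2 : Tendsto (fun j : ℕ => 1 - ((U (m + j * Y) : ℝ))⁻¹) atTop (𝓝 (1 - 0)) :=
        tendsto_const_nhds.sub h1.inv_tendsto_atTop
      rw [sub_zero] at h2
      refine h2.congr fun j => ?_
      simp only [T, List.drop_zero, listVal_maxWord hU, Nat.sub_zero]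
      rw [Nat.cast_sub (hU.pos _)]
      have := (hUpos (m + j * Y)).ne'
      field_simp
      simp
    | succ d ih =>
      have h1 := ((tendsto_ratio hβ hY hpY hm d).mul ih).sub
        (tendsto_const_nhds (x := (W d : ℝ)))
      refine h1.congr' ?_
      filter_upwards [hW d] with j hj
      obtain ⟨hd, hWd⟩ := hj
      simp only [T]
      rw [List.drop_eq_getElem_cons hd, hWd, listVal, List.length_drop, length_maxWord]
      have e1 := (hUpos (m + j * Y - d)).ne'
      have e2 := (hUpos (m + j * Y - (d + 1))).ne'
      push_cast
      field_simp
      ring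
  refine ⟨ρ, ⟨fun d => ?_, fun d => ?_, fun d => rfl⟩, rfl⟩
  · exact ge_of_tendsto' (hlim d) fun j => by positivity
  · refine le_of_tendsto (hlim d) (eventually_atTop.mpr ⟨d, fun j hj => ?_⟩)
    rw [div_le_one (hUpos _)]
    have := hjY j
    exact_mod_cast (listVal_drop_greedyDigits_lt hU (sub_one_lt hU (m + j * Y))
      (by omega : d ≤ m + j * Y)).le

/-! ### The defect of quasi-greedy prefixes -/

/-- The difference between `U m` and the value of the prefix of length `m` of the quasi-greedy
expansion at `v`. -/
noncomputable def defect (U : ℕ → ℕ) {p : ℕ} [NeZero p] (β : Fin p → ℝ) (v : Fin p) (m : ℕ) : ℤ :=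
  U m - prefixVal U (quasiDigit β v) m

/-- The `U k` of the lowered digit cancels against the leading term of the defect at the next
vertex. -/
theorem Delta_eq_defect_sub {U : ℕ → ℕ} {p : ℕ} [NeZero p] {β : Fin p → ℝ}
    (hβ : ∀ v, 1 ≤ β v) {v : Fin p} (hfin : IsFiniteExp β v) {n k : ℕ}
    (hn : n * p = v + len β v + k) :
    Delta U β v n = defect U β v (len β v + k) - defect U β (next β v) k := by
  rw [Delta, if_pos (by omega), defect, defect, prefixVal_quasiDigit hβ U hfin,
    show n * p - (v : ℕ) = len β v + k by omega]
  have : ∑ l ∈ Finset.Icc 1 (len β v), (digit β v (l - 1) : ℤ) * U (len β v + k - l) =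
      ∑ d ∈ Finset.range (len β v), (digit β v d : ℤ) * U (len β v + k - 1 - d) := by
    rw [Finset.range_eq_Ico, ← Finset.Ico_succ_right_eq_Icc, Order.succ_eq_add_one,
      ← zero_add (1 : ℕ), ← Finset.sum_Ico_add']
    simp [Nat.sub_sub, add_comm 1]
  rw [this]
  ring

/-- Replacing the suffix `z` by the next letters of `W` changes the value by an amount independent
of `j`, since those letters start at `h + j * Y` and `W` has period `Y` from `h` on. -/
theorem exists_sub_prefixVal_eq_const {U : ℕ → ℕ} (hU : IsPositional U) {W : ℕ → ℕ}
    {z : List ℕ} {h Y m : ℕ} (hm : m = h + z.length) (hper : ∀ d ≥ h, W (d + Y) = W d)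
    (hword : ∀ j, maxWord U (m + j * Y) = (List.range (h + j * Y)).map W ++ z) :
    ∃ C : ℤ, ∀ j, (U (m + j * Y) : ℤ) = prefixVal U W (m + j * Y) + C := by
  have hper' : ∀ j, ∀ d ≥ h, W (d + j * Y) = W d := by
    intro j d hd
    induction j with
    | zero => simp
    | succ j ih => rw [add_mul, one_mul, ← add_assoc, hper _ (by omega), ih]
  refine ⟨1 + listVal U z -
    ∑ d ∈ Finset.range z.length, (W (h + d) : ℤ) * U (z.length - 1 - d), fun j => ?_⟩
  have h1 := listVal_maxWord hU (m + j * Y)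
  rw [hword, listVal_map_range_append] at h1
  have h2 : (U (m + j * Y) : ℤ) = ((U (m + j * Y) - 1 : ℕ) : ℤ) + 1 := by
    rw [Nat.cast_sub (hU.pos _)]
    simp
  have h3 : m + j * Y = h + j * Y + z.length := by omega
  have h4 : prefixVal U (fun d => W (h + j * Y + d)) z.length =
      ∑ d ∈ Finset.range z.length, (W (h + d) : ℤ) * U (z.length - 1 - d) :=
    Finset.sum_congr rfl fun d _ => by
      beta_reduce
      rw [show h + j * Y + d = h + d + j * Y by ring, hper' j (h + d) (by omega)]
  rw [h2, ← h1, h3, prefixVal_add, h4]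
  push_cast
  ring

theorem defect_dichotomy {U : ℕ → ℕ} (hU : IsPositional U) {p : ℕ} [NeZero p]
    {β : Fin p → ℝ} (hβ : IsAssociatedBase U β) {V : Set (Fin p)}
    (hV : ∀ v ∈ V, IsFiniteExp β v ∧ next β v ∈ V) {v : Fin p} (hv : v ∈ V) {m Y : ℕ}
    (hY : 1 ≤ Y) (hpY : p ∣ Y) (hm : p ∣ (v : ℕ) + m)
    (hword : ∃ (W : ℕ → ℕ) (z : List ℕ) (h : ℕ), m = h + z.length ∧
      (∀ d ≥ h, W (d + Y) = W d) ∧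
        ∀ j, maxWord U (m + j * Y) = (List.range (h + j * Y)).map W ++ z) :
    (∃ C : ℤ, ∀ j, defect U β v (m + j * Y) = C) ∨
      ∃ o, 1 ≤ o ∧ ∃ u ∈ V, u = Fin.ofNat p ((v : ℕ) + o) ∧ ∃ C : ℤ, ∀ j, o ≤ m + j * Y →
        defect U β v (m + j * Y) = defect U β u (m + j * Y - o) + C := by
  obtain ⟨W, z, h, hmh, hper, hw⟩ := hword
  obtain ⟨C, hC⟩ := exists_sub_prefixVal_eq_const hU hmh hper hw
  have hWd : ∀ d, ∀ᶠ j in atTop, ∃ hd : d < (maxWord U (m + j * Y)).length,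
      (maxWord U (m + j * Y))[d] = W d := by
    refine fun d => eventually_atTop.mpr ⟨d + 1, fun j hj => ?_⟩
    have hjY : j ≤ j * Y := Nat.le_mul_of_pos_right _ hY
    refine ⟨by rw [length_maxWord]; omega, ?_⟩
    simp only [hw]
    rw [List.getElem_append_left (by simp; omega)]
    simp
  obtain ⟨ρ, hρ, hρ0⟩ := exists_isTailValue hU hβ hY hpY hm hWd
  rcases hρ.dichotomy (one_le_base hU hβ) V hV U hv hρ0 with hq | ⟨o, ho, u, huV, hu, hval⟩
  · refine Or.inl ⟨C, fun j => ?_⟩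
    rw [defect, hC, funext hq]
    ring
  · refine Or.inr ⟨o, ho, u, huV, hu, C, fun j hj => ?_⟩
    have := hval (m + j * Y - o)
    rw [Nat.add_sub_cancel' hj] at this
    rw [defect, defect, hC, this]
    ring

/-! ### Vertices of positions -/

/-- The residue `v` such that `m ≡ -v` modulo `p`. -/
def vertex (p : ℕ) [NeZero p] (m : ℕ) : Fin p := Fin.ofNat p (p * m - m)

theorem dvd_vertex_add (p : ℕ) [NeZero p] (m : ℕ) : p ∣ (vertex p m : ℕ) + m := by
  have hle : m ≤ p * m := Nat.le_mul_of_pos_left _ (NeZero.pos p)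
  have h : (vertex p m : ℕ) + m ≡ p * m - m + m [MOD p] := (Nat.mod_modEq _ _).add_right m
  rw [Nat.sub_add_cancel hle] at h
  exact (h.dvd_iff dvd_rfl).mpr (dvd_mul_right _ _)

theorem vertex_eq {p : ℕ} [NeZero p] {m : ℕ} {v : Fin p} (h : p ∣ (v : ℕ) + m) :
    vertex p m = v := by
  have h1 : (vertex p m : ℕ) + m ≡ v + m [MOD p] :=
    ((Nat.modEq_zero_iff_dvd.mpr (dvd_vertex_add p m)).trans
      (Nat.modEq_zero_iff_dvd.mpr h).symm)
  exact Fin.ext ((Nat.ModEq.add_right_cancel' m h1).eq_of_lt_of_lt (Fin.is_lt _) v.2)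

theorem vertex_congr {p : ℕ} [NeZero p] {m n : ℕ} (h : m ≡ n [MOD p]) :
    vertex p m = vertex p n :=
  vertex_eq (((h.add_left _).dvd_iff dvd_rfl).mpr (dvd_vertex_add p n))

theorem vertex_sub {p : ℕ} [NeZero p] {m o : ℕ} (h : o ≤ m) :
    vertex p (m - o) = Fin.ofNat p ((vertex p m : ℕ) + o) := by
  refine vertex_eq ?_
  have h1 : ((Fin.ofNat p ((vertex p m : ℕ) + o) : Fin p) : ℕ) + (m - o) ≡
      vertex p m + o + (m - o) [MOD p] := (Nat.mod_modEq _ _).add_right _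
  rw [show (vertex p m : ℕ) + o + (m - o) = vertex p m + m by omega] at h1
  exact (h1.dvd_iff dvd_rfl).mpr (dvd_vertex_add p m)

/-- On a set of vertices with regular languages that is closed under the successor map, the
defects are ultimately affine along residue classes. -/
theorem exists_defect_step {U : ℕ → ℕ} (hU : IsPositional U) {p : ℕ} [NeZero p]
    {β : Fin p → ℝ} (hβ : IsAssociatedBase U β) {V : Set (Fin p)}
    (hV : ∀ v ∈ V, IsFiniteExp β v ∧ next β v ∈ V)
    (hreg : ∀ v ∈ V, (maxLang U p v).IsRegular) :
    ∃ K Y, 1 ≤ K ∧ p ∣ Y ∧ Y ∣ K ∧ ∃ N, ∃ D : ℕ → ℤ, ∀ m ≥ N, ∀ v ∈ V, p ∣ (v : ℕ) + m →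
      defect U β v (m + K) = defect U β v m + D (m % Y) := by
  choose! N hN using fun v hv => exists_periodic_maxWord hU v (hreg v hv)
  set N₀ := ∑ v, N v with hN₀
  have hNle : ∀ v, N v ≤ N₀ := fun v =>
    Finset.single_le_sum (f := N) (fun _ _ => Nat.zero_le _) (Finset.mem_univ v)
  -- A multiple of `p`, so that residues mod `Y` determine vertices, and of every possible pumping
  -- length.
  set Y := p * N₀.factorial with hYdef
  have hY : 1 ≤ Y := Nat.mul_pos (NeZero.pos p) (Nat.factorial_pos _)
  have hpY : p ∣ Y := dvd_mul_right _ _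
  have hdiv : ∀ k, 1 ≤ k → k ≤ N₀ → k ∣ Y := fun k h1 h2 =>
    (Nat.dvd_factorial h1 h2).mul_left p
  obtain ⟨K, hK, hYK, N₁, D, hD⟩ := exists_common_affine_step
    (fun m => defect U β (vertex p m) m) (fun m => vertex p m ∈ V) Y hY fun a ha => by
      have hvert : ∀ m, m ≡ a [MOD Y] → vertex p m = vertex p (a % Y) := fun m hm =>
        vertex_congr ((hm.trans (Nat.mod_modEq a Y).symm).of_dvd hpY)
      -- A member of the class of `a` beyond all pumping constants.
      set m₀ := a % Y + Y * (N₀ + 1) with hm₀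
      have hm₀a : m₀ ≡ a [MOD Y] := by simp [hm₀, Nat.ModEq]
      have hm₀N : N₀ + 1 ≤ m₀ := (Nat.le_mul_of_pos_left _ hY).trans (Nat.le_add_left _ _)
      have hdvd : p ∣ (vertex p (a % Y) : ℕ) + m₀ := by
        rw [← hvert m₀ hm₀a]
        exact dvd_vertex_add p m₀
      have hreach : ∀ m ≥ m₀, m ≡ a [MOD Y] → ∃ j, m = m₀ + j * Y := fun m hm hma => by
        obtain ⟨j, hj⟩ := (Nat.modEq_iff_dvd' hm).mp (hm₀a.trans hma.symm)
        exact ⟨j, by rw [mul_comm j, ← hj]; omega⟩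
      rcases defect_dichotomy hU hβ hV ha hY hpY hdvd (hN _ ha Y hY
        (fun k h1 h2 => hdiv k h1 (h2.trans (hNle _))) m₀
        (by have := hNle (vertex p (a % Y)); omega) (by omega) hdvd) with
        ⟨C, hC⟩ | ⟨o, ho, u, huV, hu, C, hC⟩
      · refine Or.inl ⟨C, m₀, fun m hm hma => ?_⟩
        obtain ⟨j, rfl⟩ := hreach m hm hma
        rw [hvert _ hma, hC]
      · refine Or.inr ⟨o, ho, C, m₀ + o, fun m hm hma => ?_⟩
        obtain ⟨j, rfl⟩ := hreach m (by omega) hma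
        have hsub : vertex p (m₀ + j * Y - o) = u := by
          rw [vertex_sub (by omega), hvert _ hma, hu]
        refine ⟨?_, ?_⟩
        · rw [vertex_congr ((Nat.mod_modEq _ Y).of_dvd hpY), hsub]
          exact huV
        · rw [hsub, hvert _ hma, hC j (by omega)]
  refine ⟨K, Y, hK, hpY, hYK, N₁, D, fun m hm v hv hvm => ?_⟩
  have hvK : p ∣ (v : ℕ) + (m + K) := by
    rw [← add_assoc]
    exact dvd_add hvm (hpY.trans hYK)
  have h := hD m hm (by
    rw [vertex_congr ((Nat.mod_modEq _ Y).of_dvd hpY), vertex_eq hvm]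
    exact hv)
  simpa only [vertex_eq hvm, vertex_eq hvK] using h

/-- The second difference of `Δ_v` with a suitable step is ultimately zero. -/
theorem exists_Delta_second_difference {U : ℕ → ℕ} (hU : IsPositional U) {p : ℕ} [NeZero p]
    {β : Fin p → ℝ} (hβ : IsAssociatedBase U β) {V : Set (Fin p)}
    (hV : ∀ v ∈ V, IsFiniteExp β v ∧ next β v ∈ V)
    (hreg : ∀ v ∈ V, (maxLang U p v).IsRegular) {v : Fin p} (hv : v ∈ V) :
    ∃ M, 1 ≤ M ∧ ∃ N, ∀ n ≥ N, Delta U β v (n + M + M) - Delta U β v (n + M) =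
      Delta U β v (n + M) - Delta U β v n := by
  obtain ⟨K, Y, hK, hpY, hYK, N, D, hD⟩ := exists_defect_step hU hβ hV hreg
  obtain ⟨M, hM⟩ := hpY.trans hYK
  obtain ⟨hfin, hnext⟩ := hV v hv
  have hp : 0 < p := NeZero.pos p
  -- Adding M = K/p to `n` shifts both positions by `K`, so the first difference depends only on the
  -- position `k` mod `Y`; as `Y` divides `K`, a further shift leaves it unchanged.
  have hfirst : ∀ k ≥ N, ∀ n, n * p = v + len β v + k →
      Delta U β v (n + M) - Delta U β v n = D ((len β v + k) % Y) - D (k % Y) := by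
    intro k hk n hn
    have hd1 : p ∣ (v : ℕ) + (len β v + k) := ⟨n, by rw [← add_assoc, ← hn, mul_comm]⟩
    have hd2 : p ∣ (next β v : ℕ) + k := by
      have h1 : (next β v : ℕ) + k ≡ v + len β v + k [MOD p] :=
        (Nat.mod_modEq _ _).add_right k
      rw [← add_assoc] at hd1
      exact (h1.dvd_iff dvd_rfl).mpr hd1
    rw [Delta_eq_defect_sub (one_le_base hU hβ) hfin hn,
      Delta_eq_defect_sub (one_le_base hU hβ) hfin (n := n + M) (k := k + K)
        (by rw [hM, add_mul, hn, mul_comm M]; ring),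
      ← add_assoc, hD _ (by omega) v hv hd1, hD _ hk _ hnext hd2]
    ring
  refine ⟨M, Nat.pos_of_ne_zero ?_, v + len β v + N, fun n hn => ?_⟩
  · rintro rfl
    omega
  · have hnp : n ≤ n * p := Nat.le_mul_of_pos_right _ hp
    rw [hfirst (n * p - (v + len β v)) (by omega) n (by omega),
      hfirst (n * p - (v + len β v) + K) (by omega) (n + M)
        (by rw [add_mul, hM, mul_comm M]; omega)]
    obtain ⟨c, rfl⟩ := hYK
    rw [← add_assoc, Nat.add_mul_mod_self_left, Nat.add_mul_mod_self_left]

/-! ### Orbits of the successor map -/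

theorem succ_eq_some {p : ℕ} [NeZero p] {β : Fin p → ℝ} {v u : Fin p}
    (h : succ β v = some u) : IsFiniteExp β v ∧ next β v = u := by
  rw [succ] at h
  split_ifs at h with hfin
  exact ⟨hfin, Option.some.inj h⟩

theorem exists_succ_of_succIter {p : ℕ} [NeZero p] {β : Fin p → ℝ} {i v w : Fin p} {h k : ℕ}
    (hv : succIter β h i = some v) (hlt : h < k) (hk : succIter β k i = some w) :
    ∃ u, succ β v = some u ∧ succIter β (h + 1) i = some u := by
  have hs : succIter β (h + 1) i = succ β v := by rw [succIter, hv, Option.bind_some]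
  have hnone : succIter β (h + 1) i = none → ∀ d, succIter β (h + 1 + d) i = none := by
    intro h0 d
    induction d with
    | zero => exact h0
    | succ d ih => rw [← add_assoc, succIter, ih, Option.bind_none]
  cases hu : succ β v with
  | none =>
    have := hnone (hs.trans hu) (k - (h + 1))
    rw [Nat.add_sub_cancel' (by omega), hk] at this
    exact absurd this (by simp)
  | some u => exact ⟨u, rfl, hs.trans hu⟩

/-- Only the last vertex could leave the set, and its successor is σ^{s+r}(i) = σ^s(i), with s < s +
r. -/
theorem orbit_closed {p : ℕ} [NeZero p] {β : Fin p → ℝ} {i : Fin p} {s r : ℕ} (hr : 1 ≤ r)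
    (hsr : Returns β i s r) (v : Fin p)
    (hv : v ∈ {v | ∃ h < s + r, succIter β h i = some v}) :
    IsFiniteExp β v ∧ next β v ∈ {v | ∃ h < s + r, succIter β h i = some v} := by
  obtain ⟨w, hs, hw⟩ := hsr
  obtain ⟨h, hlt, hh⟩ := hv
  obtain ⟨u, hu, hu'⟩ := exists_succ_of_succIter hh hlt hw
  obtain ⟨hfin, rfl⟩ := succ_eq_some hu
  refine ⟨hfin, ?_⟩
  rcases Nat.eq_or_lt_of_le (Nat.succ_le_of_lt hlt) with he | hlt'
  · rw [Nat.succ_eq_add_one] at he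
    rw [he, hw] at hu'
    exact ⟨s, by omega, hs.trans hu'⟩
  · exact ⟨h + 1, hlt', hu'⟩

end NumSys

theorem mainTheorem10 (U : ℕ → ℕ) (hU : NumSys.IsPositional U)
    (p : ℕ) [NeZero p] (β : Fin p → ℝ) (hβ : NumSys.IsAssociatedBase U β)
    (i : Fin p) (s r : ℕ) (hr : 1 ≤ r) (hsr : NumSys.Returns β i s r)
    (hs : IsLeast {s' : ℕ | 1 ≤ s' ∧ ∃ r' : ℕ, 1 ≤ r' ∧ NumSys.Returns β i s' r'} s)
    (hreg : ∀ h < s + r, ∀ v : Fin p, NumSys.succIter β h i = some v →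
      (NumSys.maxLang U p v).IsRegular) :
    ∃ M : ℕ, 1 ≤ M ∧
      LinSeq.EigenvalueCondition (fun n => (NumSys.Delta U β i n : ℂ)) M ∧
      LinSeq.DifferenceCondition (fun n => (NumSys.Delta U β i n : ℂ)) M := by
  obtain ⟨M, hM, N, hN⟩ := NumSys.exists_Delta_second_difference hU hβ
    (NumSys.orbit_closed hr hsr) (fun v ⟨h, hlt, hv⟩ => hreg h hlt v hv)
    (v := i) ⟨0, by omega, rfl⟩
  have hdiff : LinSeq.DifferenceCondition (fun n => (NumSys.Delta U β i n : ℂ)) M :=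
    ⟨N, fun n hn => by
      beta_reduce
      exact_mod_cast hN n hn⟩
  exact ⟨M, hM, LinSeq.eigenvalueCondition_of_differenceCondition hM hdiff, hdiff⟩
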